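/- Let $X$ be a real analytic manifold of dimension $n$, let $\chi=\{M_1,\dots,M_\ell\}$ be a finite family of closed real analytic submanifolds of $X$, and let $q\in M_1\cap\dots\cap M_\ell$. For a submanifold $N$ of $X$ and $q \in N$, let $(T_N^*X)_q\subseteq (T^*X)_q$ be the fibre at $q$ of its conormal bundle, that is, the space of covectors at $q$ vanishing on $T_qN$. Then the following conditions are equivalent. (i) $\chi$ is simultaneously linearizable at $q$, that is: for all $1\le j,k\le \ell$ the submanifolds $M_j$ and $M_k$ intersect cleanly at $q$, which means that $M_j\cap M_k$ is a closed real analytic submanifold in a neighborhood of $q$ and $(T_{M_j}^*X)_q+(T_{M_k}^*X)_q=(T_{M_j\cap M_k}^*X)_q$; and there exist a vector subspace $V$ of $(T^*X)_q$ and a direct sum decomposition $V=V_1\oplus\dots\oplus V_m$ into vector subspaces such that every $(T_{M_j}^*X)_q$ $(1\le j\le\ell)$ is the direct sum of some of the $V_k$. (ii) There exist an open neighborhood $W$ of $q$ in $X$, an open neighborhood $U$ of $0$ in $\mathbb{R}^n$ with coordinates $(x_1,\dots,x_n)$, a real analytic isomorphism $\psi:W\to U$ with $\psi(q)=0$, and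 subsets $I_1,\dots,I_\ell$ of $\{1,\dots,n\}$ such that $\psi(M_j\cap W)=\{x\in U : x_i=0 \text{ for all } i\in I_j\}$ for every $j=1,\dots,\ell$. -/

import Mathlib

open scoped Manifold ContDiff Topology

/-! In this file `X` is a real analytic manifold of dimension `n`: a charted space over
`EuclideanSpace ℝ (Fin n)` with analytic transition maps (`IsManifold (𝓡 n) ω X`).  The elements of
`IsManifold.maximalAtlas (𝓡 n) ω X` are exactly the real analytic isomorphisms from an open subset
of `X` onto an open subset of `ℝⁿ`, i.e. the systems of local analytic coordinates. -/

section

variable (n : ℕ) {X : Type*} [TopologicalSpace X] [ChartedSpace (EuclideanSpace ℝ (Fin n)) X]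

/-- Near its point `p`, the set `S` is a real analytic submanifold: it is given, in the domain of
some system of local analytic coordinates defined near `p`, by the vanishing of some of these
coordinates. -/
def IsAnalyticSubmanifoldAt (S : Set X) (p : X) : Prop :=
  p ∈ S ∧ ∃ e ∈ IsManifold.maximalAtlas (𝓡 n) ω X, p ∈ e.source ∧
    ∃ I : Set (Fin n), ∀ x ∈ e.source, x ∈ S ↔ ∀ i ∈ I, e x i = 0

/-- `S` is a closed real analytic submanifold of `X`. -/
def IsClosedAnalyticSubmanifold (S : Set X) : Prop :=
  IsClosed S ∧ ∀ p ∈ S, IsAnalyticSubmanifoldAt n S p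

/-- The velocities at `p` of the analytic curves through `p` that stay in `S`.  If `S` is a
submanifold near `p`, this is the tangent space `T_p S`, as a subset of `T_p X`. -/
def velocitySet (S : Set X) (p : X) : Set (TangentSpace (𝓡 n) p) :=
  {v | ∃ γ : ℝ → X, γ 0 = p ∧ ContMDiffAt 𝓘(ℝ, ℝ) (𝓡 n) ω γ 0 ∧ (∀ᶠ t in 𝓝 (0 : ℝ), γ t ∈ S) ∧
    (mfderiv 𝓘(ℝ, ℝ) (𝓡 n) γ 0 (1 : ℝ) : EuclideanSpace ℝ (Fin n)) = v}

/-- The tangent space `T_p S ⊆ T_p X` of a submanifold `S`.  (The span only serves to make it a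
subspace by construction.) -/
noncomputable def tangentSubspace (S : Set X) (p : X) : Submodule ℝ (TangentSpace (𝓡 n) p) :=
  Submodule.span ℝ (velocitySet n S p)

/-- The fibre `(T_S^* X)_p` of the conormal bundle of `S`: the covectors in `(T^* X)_p` that vanish
on `T_p S`. -/
noncomputable def conormalFiber (S : Set X) (p : X) : Submodule ℝ (Module.Dual ℝ (TangentSpace (𝓡 n) p)) :=
  (tangentSubspace n S p).dualAnnihilator

/-- The submanifolds `S` and `T` intersect cleanly at `q`. -/
def IntersectCleanlyAt (S T : Set X) (q : X) : Prop :=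
  IsAnalyticSubmanifoldAt n (S ∩ T) q ∧
    conormalFiber n S q ⊔ conormalFiber n T q = conormalFiber n (S ∩ T) q

/-- The family `M` is simultaneously linearizable at `q`: its members intersect pairwise cleanly at
`q`, and there are a subspace `V` of `(T^* X)_q` and a decomposition `V = V₁ ⊕ ⋯ ⊕ Vₘ` (the
summands are `D 0, …, D (m - 1)`) such that every `(T_{M_j}^* X)_q` is the (automatically direct)
sum of some of the summands. -/
def SimultaneouslyLinearizableAt {l : ℕ} (M : Fin l → Set X) (q : X) : Prop :=
  (∀ j k, IntersectCleanlyAt n (M j) (M k) q) ∧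
    ∃ (V : Submodule ℝ (Module.Dual ℝ (TangentSpace (𝓡 n) q))) (m : ℕ)
      (D : Fin m → Submodule ℝ (Module.Dual ℝ (TangentSpace (𝓡 n) q))),
      (iSupIndep D ∧ ⨆ k, D k = V) ∧
        ∀ j, ∃ K : Set (Fin m), conormalFiber n (M j) q = ⨆ k ∈ K, D k

end

/-! Only (i) ⇒ (ii) needs work. A basis of `(T^*X)_q` adapted to the summands gives linear
coordinates in which each `T_q M_j` is a coordinate subspace, with index set `I j`; cleanness gives
the tangent space of `M_j ∩ M_k` the index set `I j ∪ I k`. Each of these sets is flattened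
separately by a diffeomorphism tangent to the identity; the point is to flatten all `M_j` at once
(`exists_flatten_family`).

This goes by induction (`exists_flatten_insert`). Let the `S j` be flat already and add `T`, with
index set `J`. Near `0`, `T` is a graph over the coordinates outside `J`; let `r x` be the point of
`T` sharing these coordinates with `x`. Replacing `x_i` by `x_i - r_i(x)` for `i ∈ J` flattens `T`,
and keeps `S j` flat provided the `r_i` with `i ∈ I j` vanish wherever the coordinates in `I j \ J`
do. But `S j ∩ T` is a graph over the coordinates outside `I j ∪ J`, so for such `x` it contains a
point agreeing with `x` outside `J`; by uniqueness this is `r x`, so `r x ∈ S j`. Only pairwise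
intersections enter.

Conversely, in a chart as in (ii) the conormal fibres are spanned by the differentials of the
coordinates in `I j`. -/

open Filter

/-! ### Germs of diffeomorphisms tangent to the identity. -/

/-- `G` is the germ at `0` of an analytic map which fixes `0` and has derivative `id` there. -/
structure IsTangentId {E : Type*} [NormedAddCommGroup E] [NormedSpace ℝ E] (G : E → E) :
    Prop where
  contDiffAt : ContDiffAt ℝ ω G 0
  map_zero : G 0 = 0
  hasFDerivAt : HasFDerivAt G (ContinuousLinearMap.id ℝ E) 0

namespace IsTangentId

variable {E : Type*} [NormedAddCommGroup E] [NormedSpace ℝ E] {G H : E → E}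

theorem id : IsTangentId (fun x : E => x) :=
  ⟨contDiffAt_id, rfl, hasFDerivAt_id 0⟩

theorem tendsto (hG : IsTangentId G) : Tendsto G (𝓝 0) (𝓝 0) := by
  have := hG.contDiffAt.continuousAt.tendsto
  rwa [hG.map_zero] at this

theorem comp (hG : IsTangentId G) (hH : IsTangentId H) : IsTangentId (fun x => G (H x)) := by
  refine ⟨?_, by rw [hH.map_zero, hG.map_zero], ?_⟩
  · exact ContDiffAt.comp (g := G) 0 (by rw [hH.map_zero]; exact hG.contDiffAt) hH.contDiffAt
  · have h := HasFDerivAt.comp (g := G) (0 : E) (by rw [hH.map_zero]; exact hG.hasFDerivAt)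
      hH.hasFDerivAt
    exact h.congr_fderiv (by ext; simp)

theorem exists_inverse [CompleteSpace E] (hG : IsTangentId G) :
    ∃ H, IsTangentId H ∧ (∀ᶠ x in 𝓝 0, H (G x) = x) ∧ ∀ᶠ x in 𝓝 0, G (H x) = x := by
  have hd : HasFDerivAt G ((ContinuousLinearEquiv.refl ℝ E : E ≃L[ℝ] E) : E →L[ℝ] E) 0 :=
    hG.hasFDerivAt
  have hs := hG.contDiffAt.hasStrictFDerivAt' hd (by simp)
  have h0 := hG.map_zero
  refine ⟨hs.localInverse G _ 0, ⟨?_, ?_, ?_⟩, hs.eventually_left_inverse, ?_⟩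
  · have := hG.contDiffAt.to_localInverse hd (by simp)
    rwa [h0] at this
  · have := hs.localInverse_apply_image
    rwa [h0] at this
  · have := hs.to_localInverse.hasFDerivAt
    rw [h0] at this
    exact this
  · have := hs.eventually_right_inverse
    rwa [h0] at this

end IsTangentId

/-! ### Simultaneous flattening of sets in `ℝⁿ`. -/

section Flattening

variable {n : ℕ}

/-- The projection of `ℝⁿ` which annihilates the coordinates in `I`. -/
noncomputable def coordProj (I : Set (Fin n)) :
    EuclideanSpace ℝ (Fin n) →L[ℝ] EuclideanSpace ℝ (Fin n) :=
  open Classical in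
  LinearMap.toContinuousLinearMap
    { toFun := fun x => WithLp.toLp 2 fun i => if i ∈ I then 0 else x i
      map_add' := fun x y => by ext i; by_cases h : i ∈ I <;> simp [h]
      map_smul' := fun c x => by ext i; by_cases h : i ∈ I <;> simp [h] }

theorem coordProj_of_mem {I : Set (Fin n)} {i : Fin n} (h : i ∈ I)
    (x : EuclideanSpace ℝ (Fin n)) : coordProj I x i = 0 := by
  simp [coordProj, h]

theorem coordProj_of_notMem {I : Set (Fin n)} {i : Fin n} (h : i ∉ I)
    (x : EuclideanSpace ℝ (Fin n)) : coordProj I x i = x i := by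
  simp [coordProj, h]

theorem coordProj_eq_self_iff {I : Set (Fin n)} {x : EuclideanSpace ℝ (Fin n)} :
    coordProj I x = x ↔ ∀ i ∈ I, x i = 0 := by
  refine ⟨fun h i hi => by rw [← h, coordProj_of_mem hi], fun h => ?_⟩
  ext i
  by_cases hi : i ∈ I
  · rw [coordProj_of_mem hi, h i hi]
  · rw [coordProj_of_notMem hi]

theorem coordProj_coordProj (I : Set (Fin n)) (x : EuclideanSpace ℝ (Fin n)) :
    coordProj I (coordProj I x) = coordProj I x :=
  coordProj_eq_self_iff.2 fun _ hi => coordProj_of_mem hi x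

theorem coordProj_tendsto (I : Set (Fin n)) : Tendsto (coordProj I) (𝓝 0) (𝓝 0) := by
  simpa using (coordProj I).continuous.tendsto 0

/-- Near `0`, the set `S` is carried to the coordinate subspace `{x | ∀ i ∈ I, x i = 0}` by an
analytic diffeomorphism tangent to the identity. -/
def IsFlattenable (S : Set (EuclideanSpace ℝ (Fin n))) (I : Set (Fin n)) : Prop :=
  ∃ G : EuclideanSpace ℝ (Fin n) → EuclideanSpace ℝ (Fin n), IsTangentId G ∧
    ∀ᶠ x in 𝓝 0, x ∈ S ↔ ∀ i ∈ I, G x i = 0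

theorem IsFlattenable.preimage {S : Set (EuclideanSpace ℝ (Fin n))} {I : Set (Fin n)}
    (hS : IsFlattenable S I) {H : EuclideanSpace ℝ (Fin n) → EuclideanSpace ℝ (Fin n)}
    (hH : IsTangentId H) : IsFlattenable (H ⁻¹' S) I := by
  obtain ⟨G, hG, hGS⟩ := hS
  exact ⟨_, hG.comp hH, hH.tendsto.eventually hGS⟩

/-- A set given near `0` by the vanishing of coordinates of a local diffeomorphism `F` is
flattenable if its tangent space at `0` is a coordinate subspace. -/
theorem IsFlattenable.of_hasFDerivAt {S : Set (EuclideanSpace ℝ (Fin n))} {I J : Set (Fin n)}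
    {F : EuclideanSpace ℝ (Fin n) → EuclideanSpace ℝ (Fin n)}
    {A : EuclideanSpace ℝ (Fin n) ≃L[ℝ] EuclideanSpace ℝ (Fin n)} (hF : ContDiffAt ℝ ω F 0)
    (hA : HasFDerivAt F (A : EuclideanSpace ℝ (Fin n) →L[ℝ] EuclideanSpace ℝ (Fin n)) 0)
    (h0 : ∀ i ∈ J, F 0 i = 0) (hS : ∀ᶠ x in 𝓝 0, x ∈ S ↔ ∀ i ∈ J, F x i = 0)
    (hker : ∀ v, (∀ i ∈ J, A v i = 0) ↔ ∀ i ∈ I, v i = 0) : IsFlattenable S I := by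
  -- Only the `J`-coordinates of `F 0` are known to vanish, so `F 0` is subtracted; `A.symm`
  -- normalizes the derivative to the identity.
  refine ⟨fun x => A.symm (F x - F 0), ⟨?_, by simp, ?_⟩, ?_⟩
  · exact A.symm.contDiff.contDiffAt.comp 0 (hF.sub contDiffAt_const)
  · have := A.symm.hasFDerivAt.comp (0 : EuclideanSpace ℝ (Fin n)) (hA.sub_const (F 0))
    exact this.congr_fderiv (by ext; simp)
  · filter_upwards [hS] with x hx
    rw [hx, ← hker]
    refine forall₂_congr fun i hi => ?_
    simp [h0 i hi]

/-- A flattenable set is the image of an analytic retraction which changes only the coordinates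
in `I` and depends only on the other ones. -/
theorem IsFlattenable.exists_retraction {S : Set (EuclideanSpace ℝ (Fin n))} {I : Set (Fin n)}
    (hS : IsFlattenable S I) :
    ∃ r : EuclideanSpace ℝ (Fin n) → EuclideanSpace ℝ (Fin n),
      ContDiffAt ℝ ω r 0 ∧ r 0 = 0 ∧ HasFDerivAt r (coordProj I) 0 ∧
      (∀ᶠ x in 𝓝 0, r x ∈ S) ∧ (∀ᶠ x in 𝓝 0, x ∈ S → r x = x) ∧
      (∀ᶠ x in 𝓝 0, ∀ i ∉ I, r x i = x i) ∧ ∀ x, r (coordProj I x) = r x := by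
  obtain ⟨F, hF, hFS⟩ := hS
  -- `G` takes its `I`-coordinates from `F` and the others from `x`, so its inverse moves only
  -- `I`-coordinates.
  set G : EuclideanSpace ℝ (Fin n) → EuclideanSpace ℝ (Fin n) :=
    fun x => F x + coordProj I (x - F x) with hGdef
  have hG : IsTangentId G := by
    refine ⟨?_, by simp [hGdef, hF.map_zero], ?_⟩
    · exact hF.contDiffAt.add
        ((coordProj I).contDiff.contDiffAt.comp 0 (contDiffAt_id.sub hF.contDiffAt))
    · have h1 := (hasFDerivAt_id (0 : EuclideanSpace ℝ (Fin n))).sub hF.hasFDerivAt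
      have h2 := hF.hasFDerivAt.add ((coordProj I).hasFDerivAt.comp 0 h1)
      exact h2.congr_fderiv (by ext; simp)
  have hGmem : ∀ x, ∀ i ∈ I, G x i = F x i := fun x i hi => by
    simp only [hGdef, PiLp.add_apply, coordProj_of_mem hi, add_zero]
  have hGnot : ∀ x, ∀ i ∉ I, G x i = x i := fun x i hi => by
    simp [hGdef, PiLp.add_apply, coordProj_of_notMem hi]
  obtain ⟨H, hH, hHG, hGH⟩ := hG.exists_inverse
  have hP := coordProj_tendsto I
  refine ⟨fun x => H (coordProj I x), ?_, by simp [hH.map_zero], ?_, ?_, ?_, ?_, ?_⟩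
  · exact ContDiffAt.comp (g := H) 0 (by simpa using hH.contDiffAt)
      (coordProj I).contDiff.contDiffAt
  · have := HasFDerivAt.comp (g := H) (0 : EuclideanSpace ℝ (Fin n))
      (by simpa using hH.hasFDerivAt) (coordProj I).hasFDerivAt
    exact this.congr_fderiv (by ext; simp)
  · filter_upwards [hP.eventually hGH, hP.eventually (hH.tendsto.eventually hFS)] with x h1 h2
    refine h2.2 fun i hi => ?_
    rw [← hGmem _ i hi, h1, coordProj_of_mem hi]
  · filter_upwards [hHG, hFS] with x h1 h2 hx
    have : coordProj I x = G x := by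
      ext i
      by_cases hi : i ∈ I
      · rw [coordProj_of_mem hi, hGmem x i hi, h2.1 hx i hi]
      · rw [coordProj_of_notMem hi, hGnot x i hi]
    rw [this, h1]
  · filter_upwards [hP.eventually hGH] with x h1 i hi
    rw [← hGnot _ i hi, h1, coordProj_of_notMem hi]
  · intro x
    simp only [coordProj_coordProj]

/-- If the sets `S j` are coordinate subspaces near `0`, and meet the flattenable set `T` in
flattenable sets of the expected dimension, then all of them can be flattened together. -/
theorem exists_flatten_insert {ι : Type*} (s : Set ι) (S : ι → Set (EuclideanSpace ℝ (Fin n)))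
    (I : ι → Set (Fin n)) {T : Set (EuclideanSpace ℝ (Fin n))} {J : Set (Fin n)}
    (hS : ∀ j ∈ s, ∀ᶠ x in 𝓝 0, x ∈ S j ↔ ∀ i ∈ I j, x i = 0)
    (hT : IsFlattenable T J) (hST : ∀ j ∈ s, IsFlattenable (S j ∩ T) (I j ∪ J)) :
    ∃ G : EuclideanSpace ℝ (Fin n) → EuclideanSpace ℝ (Fin n), IsTangentId G ∧
      (∀ j ∈ s, ∀ᶠ x in 𝓝 0, x ∈ S j ↔ ∀ i ∈ I j, G x i = 0) ∧
      ∀ᶠ x in 𝓝 0, x ∈ T ↔ ∀ i ∈ J, G x i = 0 := by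
  obtain ⟨r, hr, hr0, hrd, hrT, hTr, hrJ, hrP⟩ := hT.exists_retraction
  have hrt : Tendsto r (𝓝 0) (𝓝 0) := by
    have := hr.continuousAt.tendsto
    rwa [hr0] at this
  have hmem : ∀ x, ∀ i ∈ J, (x - r x + coordProj J x) i = x i - r x i := fun x i hi => by
    simp [coordProj_of_mem hi]
  -- Near `0` this is `x_i - r_i(x)` for `i ∈ J` and `x_i` otherwise; the derivative is `id - P + P`
  -- with `P = coordProj J`.
  refine ⟨fun x => x - r x + coordProj J x, ⟨?_, by simp [hr0], ?_⟩, ?_, ?_⟩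
  · exact (contDiffAt_id.sub hr).add (coordProj J).contDiff.contDiffAt
  · exact (((hasFDerivAt_id (0 : EuclideanSpace ℝ (Fin n))).sub hrd).add
      (coordProj J).hasFDerivAt).congr_fderiv (by ext; simp)
  · intro j hj
    obtain ⟨t, ht, ht0, -, htS, -, htJ, -⟩ := (hST j hj).exists_retraction
    have htt : Tendsto t (𝓝 0) (𝓝 0) := by
      have := ht.continuousAt.tendsto
      rwa [ht0] at this
    -- on `S j`, the coordinates in `I j ∩ J` of the retraction onto `T` vanish
    have key : ∀ᶠ x in 𝓝 0, (∀ i ∈ I j, i ∉ J → x i = 0) → ∀ i ∈ I j, r x i = 0 := by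
      filter_upwards [htS, htJ, htt.eventually (hS j hj), htt.eventually hTr]
        with x h1 h2 h3 h4 hx i hi
      have h5 : coordProj J (t x) = coordProj J x := by
        ext k
        by_cases hk : k ∈ J
        · rw [coordProj_of_mem hk, coordProj_of_mem hk]
        · rw [coordProj_of_notMem hk, coordProj_of_notMem hk]
          by_cases hk' : k ∈ I j
          · rw [h3.1 h1.1 k hk', hx k hk' hk]
          · exact h2 k (by simp [hk, hk'])
      -- `r` sees only the coordinates outside `J`, where `x` and `t x` agree, and it fixes `t x ∈
      -- T`.
      have h6 : r x = t x := by rw [← hrP x, ← h5, hrP, h4 h1.2]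
      rw [h6]
      exact h3.1 h1.1 i hi
    filter_upwards [hS j hj, key, hrJ] with x h1 h2 h3
    rw [h1]
    constructor
    · intro hx i hi
      have := h2 (fun i hi _ => hx i hi) i hi
      by_cases hiJ : i ∈ J
      · rw [hmem x i hiJ, this, hx i hi, sub_zero]
      · simp [coordProj_of_notMem hiJ, h3 i hiJ, hx i hi]
    · intro hx
      -- Coordinates outside `J` are unchanged, so the hypothesis of `key` can be read off in the
      -- new coordinates too.
      have hx' : ∀ i ∈ I j, i ∉ J → x i = 0 := fun i hi hiJ => by
        simpa [coordProj_of_notMem hiJ, h3 i hiJ] using hx i hi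
      intro i hi
      by_cases hiJ : i ∈ J
      · have := hx i hi
        rwa [hmem x i hiJ, h2 hx' i hi, sub_zero] at this
      · exact hx' i hi hiJ
  · filter_upwards [hrT, hTr, hrJ] with x h1 h2 h3
    constructor
    · intro hx i hi
      rw [hmem x i hi, h2 hx, sub_self]
    · intro hx
      have : r x = x := by
        ext i
        by_cases hi : i ∈ J
        · have := hx i hi
          rw [hmem x i hi] at this
          linarith
        · exact h3 i hi
      rwa [← this]

/-- A finite family of sets which are flattenable along with their pairwise intersections can be
flattened simultaneously. -/
theorem exists_flatten_family {ι : Type*} (s : Finset ι)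
    (S : ι → Set (EuclideanSpace ℝ (Fin n))) (I : ι → Set (Fin n))
    (hS : ∀ j k, IsFlattenable (S j ∩ S k) (I j ∪ I k)) :
    ∃ G : EuclideanSpace ℝ (Fin n) → EuclideanSpace ℝ (Fin n), IsTangentId G ∧
      ∀ j ∈ s, ∀ᶠ x in 𝓝 0, x ∈ S j ↔ ∀ i ∈ I j, G x i = 0 := by
  classical
  induction s using Finset.induction_on with
  | empty => exact ⟨_, IsTangentId.id, by simp⟩
  | insert a s _ ih =>
    obtain ⟨G, hG, hGS⟩ := ih
    obtain ⟨H, hH, hHG, hGH⟩ := hG.exists_inverse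
    obtain ⟨K, hK, hKS, hKT⟩ := exists_flatten_insert (s : Set ι) (fun j => H ⁻¹' S j) I
      (T := H ⁻¹' S a) (J := I a)
      (fun j hj => by
        filter_upwards [hH.tendsto.eventually (hGS j hj), hGH] with x h1 h2
        rw [Set.mem_preimage, h1, h2])
      -- The diagonal case `S a ∩ S a` is the flattenability of `S a` itself.
      (by simpa using (hS a a).preimage hH)
      (fun j _ => (hS j a).preimage hH)
    have pull : ∀ j, (∀ᶠ x in 𝓝 0, x ∈ H ⁻¹' S j ↔ ∀ i ∈ I j, K x i = 0) →
        ∀ᶠ x in 𝓝 0, x ∈ S j ↔ ∀ i ∈ I j, K (G x) i = 0 := fun j hj => by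
      filter_upwards [hG.tendsto.eventually hj, hHG] with x h1 h2
      rw [← h1, Set.mem_preimage, h2]
    refine ⟨_, hK.comp hG, fun j hj => ?_⟩
    rcases Finset.mem_insert.1 hj with rfl | hj
    · exact pull _ hKT
    · exact pull j (hKS j hj)

end Flattening

/-! ### Transition maps and tangent vectors in charts. -/

section Charts

variable {n : ℕ}

theorem mem_contDiffGroupoid_omega_iff
    (f : OpenPartialHomeomorph (EuclideanSpace ℝ (Fin n)) (EuclideanSpace ℝ (Fin n))) :
    f ∈ contDiffGroupoid ω (𝓡 n) ↔
      ContDiffOn ℝ ω f f.source ∧ ContDiffOn ℝ ω f.symm f.target := by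
  rw [contDiffGroupoid, mem_groupoid_of_pregroupoid]
  simp [contDiffPregroupoid]

variable {X : Type*} [TopologicalSpace X]

theorem transition_comp_eventuallyEq {e e' : OpenPartialHomeomorph X (EuclideanSpace ℝ (Fin n))}
    {p : X} (hp : p ∈ e.source) (hp' : p ∈ e'.source) :
    (e ∘ e'.symm) ∘ (e' ∘ e.symm) =ᶠ[𝓝 (e p)] id := by
  have hmem : (e.symm.trans e').source ∈ 𝓝 (e p) :=
    (e.symm.trans e').open_source.mem_nhds (by simp [hp, hp'])
  filter_upwards [hmem] with x hx
  simp only [OpenPartialHomeomorph.trans_source, OpenPartialHomeomorph.symm_source,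
    Set.mem_inter_iff, Set.mem_preimage] at hx
  simp [hx.1, hx.2]

variable [ChartedSpace (EuclideanSpace ℝ (Fin n)) X]

theorem contDiffAt_transition {e e' : OpenPartialHomeomorph X (EuclideanSpace ℝ (Fin n))}
    (he : e ∈ IsManifold.maximalAtlas (𝓡 n) ω X) (he' : e' ∈ IsManifold.maximalAtlas (𝓡 n) ω X)
    [IsManifold (𝓡 n) ω X] {p : X} (hp : p ∈ e.source)
    (hp' : p ∈ e'.source) : ContDiffAt ℝ ω (e' ∘ e.symm) (e p) := by
  have h := ((mem_contDiffGroupoid_omega_iff _).1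
    (IsManifold.compatible_of_mem_maximalAtlas he he')).1
  refine (h (e p) ?_).contDiffAt ((e.symm.trans e').open_source.mem_nhds ?_) <;>
  simp [hp, hp']

theorem exists_hasFDerivAt_transition [IsManifold (𝓡 n) ω X]
    {e e' : OpenPartialHomeomorph X (EuclideanSpace ℝ (Fin n))}
    (he : e ∈ IsManifold.maximalAtlas (𝓡 n) ω X) (he' : e' ∈ IsManifold.maximalAtlas (𝓡 n) ω X)
    {p : X} (hp : p ∈ e.source) (hp' : p ∈ e'.source) :
    ∃ A : EuclideanSpace ℝ (Fin n) ≃L[ℝ] EuclideanSpace ℝ (Fin n),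
      HasFDerivAt (e' ∘ e.symm) (A : EuclideanSpace ℝ (Fin n) →L[ℝ] _) (e p) ∧
      HasFDerivAt (e ∘ e'.symm) (A.symm : EuclideanSpace ℝ (Fin n) →L[ℝ] _) (e' p) := by
  have hA := ((contDiffAt_transition he he' hp hp').differentiableAt (by simp)).hasFDerivAt
  have hB := ((contDiffAt_transition he' he hp' hp).differentiableAt (by simp)).hasFDerivAt
  have inv : ∀ {e e' : OpenPartialHomeomorph X (EuclideanSpace ℝ (Fin n))}
      {A B : EuclideanSpace ℝ (Fin n) →L[ℝ] EuclideanSpace ℝ (Fin n)},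
      p ∈ e.source → p ∈ e'.source → HasFDerivAt (e' ∘ e.symm) A (e p) →
      HasFDerivAt (e ∘ e'.symm) B (e' p) → ∀ v, B (A v) = v := by
    intro e e' A B hp hp' hA hB v
    have h1 : HasFDerivAt ((e ∘ e'.symm) ∘ (e' ∘ e.symm)) (B.comp A) (e p) :=
      HasFDerivAt.comp (e p) (by simpa [hp] using hB) hA
    have h2 := (hasFDerivAt_id (𝕜 := ℝ) (e p)).congr_of_eventuallyEq
      (transition_comp_eventuallyEq hp hp')
    exact DFunLike.congr_fun (h1.unique h2) v
  exact ⟨ContinuousLinearEquiv.equivOfInverse _ _ (inv hp hp' hA hB) (inv hp' hp hB hA), hA, hB⟩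

/-- The tangent space at a point is the model space, read through the preferred chart there. -/
theorem mfderiv_curve_apply_one {γ : ℝ → X} (hγ : MDifferentiableAt 𝓘(ℝ, ℝ) (𝓡 n) γ 0) :
    (mfderiv 𝓘(ℝ, ℝ) (𝓡 n) γ 0 (1 : ℝ) : EuclideanSpace ℝ (Fin n)) =
      fderiv ℝ (chartAt (EuclideanSpace ℝ (Fin n)) (γ 0) ∘ γ) 0 1 := by
  rw [hγ.mfderiv]
  simp [writtenInExtChartAt, extChartAt, fderivWithin_univ]
  rfl

theorem differentiableAt_chartAt_comp_curve {γ : ℝ → X} (hγ : MDifferentiableAt 𝓘(ℝ, ℝ) (𝓡 n) γ 0) :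
    DifferentiableAt ℝ (chartAt (EuclideanSpace ℝ (Fin n)) (γ 0) ∘ γ) 0 := by
  have := hγ.differentiableWithinAt_writtenInExtChartAt
  simp [writtenInExtChartAt, extChartAt, differentiableWithinAt_univ] at this
  exact this

/-- The tangent space of a submanifold which is a coordinate subspace in the chart `e`, read in the
preferred chart at `p`. -/
theorem velocitySet_eq [IsManifold (𝓡 n) ω X]
    {e : OpenPartialHomeomorph X (EuclideanSpace ℝ (Fin n))}
    (he : e ∈ IsManifold.maximalAtlas (𝓡 n) ω X) {p : X} (hp : p ∈ e.source) {S : Set X}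
    (hpS : p ∈ S) {I : Set (Fin n)} (hS : ∀ x ∈ e.source, x ∈ S ↔ ∀ i ∈ I, e x i = 0)
    {A : EuclideanSpace ℝ (Fin n) ≃L[ℝ] EuclideanSpace ℝ (Fin n)}
    (hA : HasFDerivAt (e ∘ (chartAt (EuclideanSpace ℝ (Fin n)) p).symm)
      (A : EuclideanSpace ℝ (Fin n) →L[ℝ] _) (chartAt (EuclideanSpace ℝ (Fin n)) p p)) :
    velocitySet n S p = {v : EuclideanSpace ℝ (Fin n) | ∀ i ∈ I, A v i = 0} := by
  have hc := IsManifold.chart_mem_maximalAtlas (I := 𝓡 n) (n := ω) p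
  have hpc := mem_chart_source (EuclideanSpace ℝ (Fin n)) p
  ext v
  constructor
  · rintro ⟨γ, rfl, hγ, hγS, hv⟩ i hi
    have hγd := hγ.mdifferentiableAt (by simp)
    have h1 := (differentiableAt_chartAt_comp_curve hγd).hasFDerivAt
    have h2 := HasFDerivAt.comp (0 : ℝ) hA h1
    have h3 := (EuclideanSpace.proj i : EuclideanSpace ℝ (Fin n) →L[ℝ] ℝ).hasFDerivAt.comp (0 : ℝ) h2
    have h4 : (EuclideanSpace.proj i : EuclideanSpace ℝ (Fin n) →L[ℝ] ℝ) ∘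
        ((e ∘ (chartAt (EuclideanSpace ℝ (Fin n)) (γ 0)).symm) ∘
          (chartAt (EuclideanSpace ℝ (Fin n)) (γ 0)) ∘ γ) =ᶠ[𝓝 0] fun _ => (0 : ℝ) := by
      filter_upwards [hγS, hγ.continuousAt.eventually (e.open_source.mem_nhds hp),
        hγ.continuousAt.eventually ((chartAt _ (γ 0)).open_source.mem_nhds hpc)] with t ht1 ht2 ht3
      have := (hS _ ht2).1 ht1 i hi
      simpa [(chartAt _ (γ 0)).left_inv ht3] using this
    have h5 := DFunLike.congr_fun
      (h3.unique ((hasFDerivAt_const (0 : ℝ) (0 : ℝ)).congr_of_eventuallyEq h4)) 1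
    have h6 := mfderiv_curve_apply_one hγd
    rw [← hv, h6]
    simpa using h5
  · intro hv
    obtain ⟨B, hB, hB'⟩ := exists_hasFDerivAt_transition hc he hpc hp
    have hBA : (B : EuclideanSpace ℝ (Fin n) →L[ℝ] EuclideanSpace ℝ (Fin n)) =
        (A : EuclideanSpace ℝ (Fin n) →L[ℝ] EuclideanSpace ℝ (Fin n)) := hB.unique hA
    let w : EuclideanSpace ℝ (Fin n) := v
    -- A straight line in the chart `e` with direction `A v` stays in the coordinate subspace.
    let l : ℝ → EuclideanSpace ℝ (Fin n) := fun t => e p + t • A w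
    have hl0 : l 0 = e p := by simp [l]
    have hl : ContDiff ℝ ω l := contDiff_const.add (contDiff_id.smul contDiff_const)
    have hld : HasFDerivAt l (ContinuousLinearMap.toSpanSingleton ℝ (A w)) 0 := by
      have := ((hasFDerivAt_id (𝕜 := ℝ) (0 : ℝ)).smul_const (A w)).const_add (e p)
      exact this.congr_fderiv (by ext; simp)
    have h0 : (e.symm ∘ l) 0 = p := by simp [hl0, hp]
    have hγ : ContMDiffAt 𝓘(ℝ, ℝ) (𝓡 n) ω (e.symm ∘ l) 0 := by
      refine ContMDiffAt.comp (I' := 𝓡 n) 0 ?_ hl.contMDiff.contMDiffAt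
      refine (contMDiffOn_symm_of_mem_maximalAtlas he).contMDiffAt
        (e.open_target.mem_nhds ?_)
      rw [hl0]
      exact e.map_source hp
    refine ⟨e.symm ∘ l, h0, hγ, ?_, ?_⟩
    · have : ∀ᶠ t in 𝓝 (0 : ℝ), l t ∈ e.target :=
        hl.continuous.continuousAt.eventually
          (e.open_target.mem_nhds (by rw [hl0]; exact e.map_source hp))
      filter_upwards [this] with t ht
      refine (hS _ (e.map_target ht)).2 fun i hi => ?_
      have h1 : e p i = 0 := (hS p hp).1 hpS i hi
      have h2 : A w i = 0 := hv i hi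
      simp [e.right_inv ht, l, h1, h2]
    · refine (mfderiv_curve_apply_one (hγ.mdifferentiableAt (by simp))).trans ?_
      rw [h0]
      have h1 := HasFDerivAt.comp (0 : ℝ) (by rw [hl0]; exact hB') hld
      have h2 : fderiv ℝ (chartAt (EuclideanSpace ℝ (Fin n)) p ∘ e.symm ∘ l) 0 = _ := h1.fderiv
      have h3 : A w = B w := DFunLike.congr_fun hBA.symm w
      rw [h2]
      simp only [ContinuousLinearMap.comp_apply, ContinuousLinearMap.toSpanSingleton_apply, one_smul, h3]
      exact B.symm_apply_apply w

end Charts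

/-! ### Adapted bases and annihilators. -/

section LinearAlgebra

variable {W : Type*} [AddCommGroup W] [Module ℝ W]

/-- An independent family of subspaces admits an adapted basis of the whole space. -/
theorem iSupIndep.exists_adapted_basis [FiniteDimensional ℝ W] {κ : Type*} [Finite κ] {D : κ → Submodule ℝ W}
    (hD : iSupIndep D) {n : ℕ} (hn : Module.finrank ℝ W = n) :
    ∃ (b : Module.Basis (Fin n) ℝ W) (c : κ → Set (Fin n)),
      ∀ k, D k = Submodule.span ℝ (b '' c k) := by
  classical
  have := Fintype.ofFinite κ
  let v := fun k => Module.finBasis ℝ (D k)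
  -- Concatenated bases of the summands, to be extended to a basis of `W`.
  let w : (Σ k, Fin (Module.finrank ℝ (D k))) → W := fun a => v a.1 a.2
  have hw : LinearIndependent ℝ w := by
    rw [Fintype.linearIndependent_iff]
    rintro g hg ⟨k, i⟩
    rw [Fintype.sum_sigma] at hg
    have h1 := (iSupIndep_iff_finsetSum_eq_zero_imp_eq_zero D).1 hD Finset.univ
      (fun k => ∑ i, g ⟨k, i⟩ • w ⟨k, i⟩)
      (fun k _ => Submodule.sum_mem _ fun i _ => Submodule.smul_mem _ _ (v k i).2) hg k
      (Finset.mem_univ k)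
    refine Fintype.linearIndependent_iff.1 (v k).linearIndependent (fun i => g ⟨k, i⟩) ?_ i
    ext
    simpa [w] using h1
  let b := Module.Basis.extend hw.linearIndepOn_id
  have hb : Set.range w ⊆ Set.range b := by
    rw [Module.Basis.range_extend]
    exact Module.Basis.subset_extend _
  have := FiniteDimensional.fintypeBasisIndex b
  let e := Fintype.equivFinOfCardEq ((Module.finrank_eq_card_basis b).symm.trans hn)
  refine ⟨b.reindex e, fun k => (b.reindex e) ⁻¹' Set.range fun i => w ⟨k, i⟩, fun k => ?_⟩
  rw [Set.image_preimage_eq_of_subset]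
  · have h1 : (Set.range fun i => w ⟨k, i⟩) = (D k).subtype '' Set.range (v k) := by
      rw [← Set.range_comp]
      rfl
    rw [h1, Submodule.span_image, (v k).span_eq, Submodule.map_top, Submodule.range_subtype]
  · rw [Module.Basis.range_reindex]
    exact (Set.range_subset_iff.2 fun i => Set.mem_range_self _).trans hb

theorem mem_dualCoannihilator_span_image_iff {ι : Type*} {φ : ι → Module.Dual ℝ W} {I : Set ι}
    {v : W} :
    v ∈ (Submodule.span ℝ (φ '' I)).dualCoannihilator ↔ ∀ i ∈ I, φ i v = 0 := by
  rw [Submodule.mem_dualCoannihilator]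
  refine ⟨fun hv i hi => hv _ (Submodule.subset_span (Set.mem_image_of_mem φ hi)),
    fun hv f hf => ?_⟩
  induction hf using Submodule.span_induction with
  | mem f hf => obtain ⟨i, hi, rfl⟩ := hf; exact hv i hi
  | zero => rfl
  | add f g _ _ hf hg => rw [LinearMap.add_apply, hf, hg, add_zero]
  | smul c f _ hf => rw [LinearMap.smul_apply, hf, smul_zero]

/-- A subspace is recovered from its annihilator, so conormal data give equations of the tangent
space. -/
theorem mem_iff_forall_of_dualAnnihilator_eq_span {ι : Type*} {φ : ι → Module.Dual ℝ W}
    {I : Set ι} {T : Submodule ℝ W} (h : T.dualAnnihilator = Submodule.span ℝ (φ '' I)) (v : W) :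
    v ∈ T ↔ ∀ i ∈ I, φ i v = 0 := by
  rw [← Subspace.dualAnnihilator_dualCoannihilator_eq (W := T), h,
    mem_dualCoannihilator_span_image_iff]

theorem dualAnnihilator_eq_span_of_mem_iff [FiniteDimensional ℝ W] {ι : Type*}
    {φ : ι → Module.Dual ℝ W} {I : Set ι} {T : Submodule ℝ W}
    (h : ∀ v, v ∈ T ↔ ∀ i ∈ I, φ i v = 0) :
    T.dualAnnihilator = Submodule.span ℝ (φ '' I) := by
  rw [← Subspace.dualCoannihilator_dualAnnihilator_eq (W := Submodule.span ℝ (φ '' I))]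
  congr 1
  ext v
  rw [h, mem_dualCoannihilator_span_image_iff]

theorem span_image_eq_biSup {ι : Type*} (φ : ι → W) (I : Set ι) :
    Submodule.span ℝ (φ '' I) = ⨆ i ∈ I, Submodule.span ℝ {φ i} := by
  rw [Submodule.span_eq_iSup_of_singleton_spans, iSup_image]

end LinearAlgebra

/-! ### Conormal fibres in a chart; (ii) ⇒ (i). -/

section Conormal

variable {n : ℕ} {X : Type*} [TopologicalSpace X] [ChartedSpace (EuclideanSpace ℝ (Fin n)) X]

instance finiteDimensional_tangentSpace (p : X) : FiniteDimensional ℝ (TangentSpace (𝓡 n) p) :=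
  inferInstanceAs (FiniteDimensional ℝ (EuclideanSpace ℝ (Fin n)))

theorem finrank_dual_tangentSpace (p : X) :
    Module.finrank ℝ (Module.Dual ℝ (TangentSpace (𝓡 n) p)) = n := by
  rw [Subspace.dual_finrank_eq]
  exact finrank_euclideanSpace_fin (𝕜 := ℝ)

/-- The velocities already form a linear subspace, so taking the span adds nothing. -/
theorem mem_tangentSubspace_iff [IsManifold (𝓡 n) ω X]
    {e : OpenPartialHomeomorph X (EuclideanSpace ℝ (Fin n))}
    (he : e ∈ IsManifold.maximalAtlas (𝓡 n) ω X) {p : X} (hp : p ∈ e.source) {S : Set X}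
    (hpS : p ∈ S) {I : Set (Fin n)} (hS : ∀ x ∈ e.source, x ∈ S ↔ ∀ i ∈ I, e x i = 0)
    {A : EuclideanSpace ℝ (Fin n) ≃L[ℝ] EuclideanSpace ℝ (Fin n)}
    (hA : HasFDerivAt (e ∘ (chartAt (EuclideanSpace ℝ (Fin n)) p).symm)
      (A : EuclideanSpace ℝ (Fin n) →L[ℝ] _) (chartAt (EuclideanSpace ℝ (Fin n)) p p))
    (v : EuclideanSpace ℝ (Fin n)) :
    (v : TangentSpace (𝓡 n) p) ∈ tangentSubspace n S p ↔ ∀ i ∈ I, A v i = 0 := by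
  have h := velocitySet_eq he hp hpS hS hA
  refine ⟨fun hv => ?_, fun hv => Submodule.subset_span (h.symm ▸ hv : _ ∈ velocitySet n S p)⟩
  unfold tangentSubspace at hv
  rw [h] at hv
  induction hv using Submodule.span_induction with
  | mem x hx => exact hx
  | zero => intro i _; exact congrArg (fun y : EuclideanSpace ℝ (Fin n) => y i) (map_zero A)
  | add x y _ _ hx hy =>
    intro i hi
    have h1 := congrArg (fun z : EuclideanSpace ℝ (Fin n) => z i)
      (map_add A (x : EuclideanSpace ℝ (Fin n)) (y : EuclideanSpace ℝ (Fin n)))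
    exact h1.trans (by simp [hx i hi, hy i hi])
  | smul c x _ hx =>
    intro i hi
    have h1 := congrArg (fun z : EuclideanSpace ℝ (Fin n) => z i)
      (map_smul A c (x : EuclideanSpace ℝ (Fin n)))
    exact h1.trans (by simp [hx i hi])

/-- The covectors `d(xᵢ)`, where the coordinates `xᵢ` have differential `A`. -/
noncomputable def coordCovector (A : EuclideanSpace ℝ (Fin n) ≃L[ℝ] EuclideanSpace ℝ (Fin n))
    (p : X) (i : Fin n) : Module.Dual ℝ (TangentSpace (𝓡 n) p) :=
  ((EuclideanSpace.proj i : EuclideanSpace ℝ (Fin n) →L[ℝ] ℝ).comp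
    (A : EuclideanSpace ℝ (Fin n) →L[ℝ] EuclideanSpace ℝ (Fin n))).toLinearMap

theorem linearIndependent_coordCovector
    (A : EuclideanSpace ℝ (Fin n) ≃L[ℝ] EuclideanSpace ℝ (Fin n)) (p : X) :
    LinearIndependent ℝ (coordCovector A p) := by
  rw [Fintype.linearIndependent_iff]
  intro g hg i
  have hx : ∀ x, ∑ j, g j * coordCovector A p j x = 0 := fun x => by
    simpa using DFunLike.congr_fun hg x
  have h : ∑ j, g j * A (A.symm (EuclideanSpace.single i 1)) j = 0 := hx _
  simpa using h

/-- Coordinate subspaces with respect to one chart are simultaneously linearizable. -/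
theorem simultaneouslyLinearizableAt_of_chart [IsManifold (𝓡 n) ω X] {l : ℕ} {M : Fin l → Set X}
    {q : X} (hq : ∀ j, q ∈ M j) {ψ : OpenPartialHomeomorph X (EuclideanSpace ℝ (Fin n))}
    (hψ : ψ ∈ IsManifold.maximalAtlas (𝓡 n) ω X) (hqψ : q ∈ ψ.source) {I : Fin l → Set (Fin n)}
    (hI : ∀ j, ∀ x ∈ ψ.source, x ∈ M j ↔ ∀ i ∈ I j, ψ x i = 0) :
    SimultaneouslyLinearizableAt n M q := by
  obtain ⟨A, hA, -⟩ := exists_hasFDerivAt_transition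
    (IsManifold.chart_mem_maximalAtlas (I := 𝓡 n) (n := ω) q) hψ (mem_chart_source _ q) hqψ
  have conormal : ∀ {S : Set X} {J : Set (Fin n)}, q ∈ S →
      (∀ x ∈ ψ.source, x ∈ S ↔ ∀ i ∈ J, ψ x i = 0) →
      conormalFiber n S q = Submodule.span ℝ (coordCovector A q '' J) := fun hqS hS =>
    dualAnnihilator_eq_span_of_mem_iff (mem_tangentSubspace_iff hψ hqψ hqS hS hA)
  have inter : ∀ j k, ∀ x ∈ ψ.source, x ∈ M j ∩ M k ↔ ∀ i ∈ I j ∪ I k, ψ x i = 0 := by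
    intro j k x hx
    rw [Set.mem_inter_iff, hI j x hx, hI k x hx]
    simp only [Set.mem_union, or_imp, forall_and]
  refine ⟨fun j k => ⟨⟨⟨hq j, hq k⟩, ψ, hψ, hqψ, I j ∪ I k, inter j k⟩, ?_⟩, _, n,
    fun i => Submodule.span ℝ {coordCovector A q i},
    ⟨(linearIndependent_coordCovector A q).iSupIndep_span_singleton, rfl⟩, fun j => ⟨I j, ?_⟩⟩
  · rw [conormal (hq j) (hI j), conormal (hq k) (hI k), conormal (Set.mem_inter (hq j) (hq k)) (inter j k),
      Set.image_union, Submodule.span_union]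
  · rw [conormal (hq j) (hI j), span_image_eq_biSup]

end Conormal

/-! ### Construction of the common chart; (i) ⇒ (ii). -/

section Linearization

variable {n : ℕ} {X : Type*} [TopologicalSpace X] [ChartedSpace (EuclideanSpace ℝ (Fin n)) X]

/-- The linear isomorphism of the tangent space with `ℝⁿ` given by a basis of covectors. -/
theorem exists_equiv_of_dual_basis {p : X}
    (b : Module.Basis (Fin n) ℝ (Module.Dual ℝ (TangentSpace (𝓡 n) p))) :
    ∃ B : EuclideanSpace ℝ (Fin n) ≃L[ℝ] EuclideanSpace ℝ (Fin n),
      ∀ (v : EuclideanSpace ℝ (Fin n)) (i : Fin n), B v i = b i v := by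
  let f : EuclideanSpace ℝ (Fin n) →ₗ[ℝ] EuclideanSpace ℝ (Fin n) :=
    { toFun := fun v => WithLp.toLp 2 fun i => b i v
      map_add' := fun v w => by ext i; exact map_add (b i) _ _
      map_smul' := fun c v => by ext i; exact map_smul (b i) c _ }
  have hf : Function.Injective f := by
    have hb : ∀ x, (∀ i, b i x = 0) → x = 0 := fun x hx => by
      refine (Module.forall_dual_apply_eq_zero_iff ℝ x).1 fun φ => ?_
      rw [← b.sum_repr φ, LinearMap.sum_apply]
      exact Finset.sum_eq_zero fun i _ => by rw [LinearMap.smul_apply, hx, smul_zero]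
    exact (injective_iff_map_eq_zero f).2 fun v hv =>
      hb v fun i => congrArg (fun y : EuclideanSpace ℝ (Fin n) => y i) hv
  exact ⟨(LinearEquiv.ofInjectiveEndo f hf).toContinuousLinearEquiv, fun v i => rfl⟩

/-- An analytic map with invertible derivative, followed after the chart `e`, gives a chart. The
domain may be chosen such that a given property which holds near the point holds on all of it. -/
theorem exists_chart_of_hasFDerivAt {e : OpenPartialHomeomorph X (EuclideanSpace ℝ (Fin n))}
    (he : e ∈ IsManifold.maximalAtlas (𝓡 n) ω X) {p : X} (hp : p ∈ e.source)
    {f : EuclideanSpace ℝ (Fin n) → EuclideanSpace ℝ (Fin n)} (hf : ContDiffAt ℝ ω f (e p))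
    {B : EuclideanSpace ℝ (Fin n) ≃L[ℝ] EuclideanSpace ℝ (Fin n)}
    (hB : HasFDerivAt f (B : EuclideanSpace ℝ (Fin n) →L[ℝ] EuclideanSpace ℝ (Fin n)) (e p))
    {P : EuclideanSpace ℝ (Fin n) → Prop} (hP : ∀ᶠ y in 𝓝 (e p), P y) :
    ∃ ψ ∈ IsManifold.maximalAtlas (𝓡 n) ω X, p ∈ ψ.source ∧ ψ.source ⊆ e.source ∧
      ∀ x ∈ ψ.source, ψ x = f (e x) ∧ P (e x) := by
  let R := hf.toOpenPartialHomeomorph f hB (by simp)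
  have hpR : e p ∈ R.source := hf.mem_toOpenPartialHomeomorph_source hB (by simp)
  have hRs : ContDiffAt ℝ ω R.symm (f (e p)) := hf.to_localInverse hB (by simp)
  -- Analyticity is an open condition, so the domain can be shrunk until `f` and its local inverse
  -- are both analytic throughout.
  have hev : ∀ᶠ y in 𝓝 (e p), P y ∧ ContDiffAt ℝ ω f y ∧ ContDiffAt ℝ ω R.symm (f y) :=
    hP.and ((hf.eventually (by simp)).and
      (hf.continuousAt.eventually (hRs.eventually (by simp))))
  obtain ⟨O, hO, hOo, hpO⟩ := eventually_nhds_iff.1 hev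
  let R' := R.restrOpen O hOo
  have hR' : R' ∈ contDiffGroupoid ω (𝓡 n) := by
    rw [mem_contDiffGroupoid_omega_iff]
    constructor
    · intro y hy
      exact (hO y hy.2).2.1.contDiffWithinAt
    · intro y hy
      have h1 : R'.symm y ∈ R'.source := R'.map_target hy
      have h2 : f (R'.symm y) = y := R'.right_inv hy
      have h3 := (hO _ h1.2).2.2
      rw [h2] at h3
      exact h3.contDiffWithinAt
  refine ⟨e.trans R', ?_, ?_, ?_, ?_⟩
  · refine (mem_maximalAtlas_iff).2 fun e' he' => ?_
    have h1 := (mem_maximalAtlas_iff).1 he e' he'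
    rw [OpenPartialHomeomorph.trans_symm_eq_symm_trans_symm, OpenPartialHomeomorph.trans_assoc,
      ← OpenPartialHomeomorph.trans_assoc e'.symm]
    exact ⟨(contDiffGroupoid ω (𝓡 n)).trans ((contDiffGroupoid ω (𝓡 n)).symm hR') h1.1,
      (contDiffGroupoid ω (𝓡 n)).trans h1.2 hR'⟩
  · rw [OpenPartialHomeomorph.trans_source]
    exact ⟨hp, hpR, hpO⟩
  · rw [OpenPartialHomeomorph.trans_source]
    exact Set.inter_subset_left
  · intro x hx
    rw [OpenPartialHomeomorph.trans_source] at hx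
    exact ⟨rfl, (hO _ hx.2.2).1⟩

/-- A submanifold is flattenable in linear coordinates `B` at `p` in which its tangent space is a
coordinate subspace. -/
theorem IsAnalyticSubmanifoldAt.isFlattenable [IsManifold (𝓡 n) ω X] {S : Set X} {p : X}
    (hS : IsAnalyticSubmanifoldAt n S p)
    {B : EuclideanSpace ℝ (Fin n) ≃L[ℝ] EuclideanSpace ℝ (Fin n)} {I : Set (Fin n)}
    (hB : ∀ v : EuclideanSpace ℝ (Fin n),
      (v : TangentSpace (𝓡 n) p) ∈ tangentSubspace n S p ↔ ∀ i ∈ I, B v i = 0) :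
    IsFlattenable {x | (chartAt (EuclideanSpace ℝ (Fin n)) p).symm
      (B.symm x + chartAt (EuclideanSpace ℝ (Fin n)) p p) ∈ S} I := by
  obtain ⟨hpS, e, he, hpe, J, hJ⟩ := hS
  set c := chartAt (EuclideanSpace ℝ (Fin n)) p
  have hc : c ∈ IsManifold.maximalAtlas (𝓡 n) ω X := IsManifold.chart_mem_maximalAtlas p
  have hpc : p ∈ c.source := mem_chart_source _ p
  obtain ⟨A, hA, -⟩ := exists_hasFDerivAt_transition hc he hpc hpe
  have hT := mem_tangentSubspace_iff he hpe hpS hJ hA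
  let t : EuclideanSpace ℝ (Fin n) → EuclideanSpace ℝ (Fin n) := fun x => B.symm x + c p
  have ht0 : t 0 = c p := by simp [t]
  have htc : ContDiff ℝ ω t := B.symm.contDiff.add contDiff_const
  have htd : HasFDerivAt t (B.symm : EuclideanSpace ℝ (Fin n) →L[ℝ] _) 0 :=
    B.symm.hasFDerivAt.add_const (c p)
  refine IsFlattenable.of_hasFDerivAt (F := (e ∘ c.symm) ∘ t) (A := B.symm.trans A) (J := J)
    ?_ ?_ ?_ ?_ ?_
  · refine ContDiffAt.comp 0 ?_ htc.contDiffAt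
    rw [ht0]
    exact contDiffAt_transition hc he hpc hpe
  · exact HasFDerivAt.comp (0 : EuclideanSpace ℝ (Fin n)) (by rw [ht0]; exact hA) htd
  · intro i hi
    have := (hJ p hpe).1 hpS i hi
    simpa [ht0, hpc] using this
  · have hcs : ContinuousAt c.symm (t 0) := by
      rw [ht0]
      exact c.symm.continuousAt (c.map_source hpc)
    have h1 : ContinuousAt (c.symm ∘ t) 0 := hcs.comp htc.continuous.continuousAt
    have h2 : (c.symm ∘ t) 0 = p := by simp [ht0, hpc]
    have h3 := h1.eventually (e.open_source.mem_nhds (by rw [h2]; exact hpe))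
    filter_upwards [h3] with x hx
    exact hJ _ hx
  · intro v
    have h1 := hT (B.symm v)
    rw [hB] at h1
    simpa using h1.symm

/-- Pairwise cleanly intersecting submanifolds whose conormal spaces are spanned by parts of one
basis become coordinate subspaces in a common chart. -/
theorem exists_chart_of_simultaneouslyLinearizableAt [IsManifold (𝓡 n) ω X] {l : ℕ}
    {M : Fin l → Set X} {q : X} (h : SimultaneouslyLinearizableAt n M q) :
    ∃ ψ ∈ IsManifold.maximalAtlas (𝓡 n) ω X, q ∈ ψ.source ∧ ψ q = 0 ∧
      ∃ I : Fin l → Set (Fin n), ∀ j, ∀ x ∈ ψ.source, x ∈ M j ↔ ∀ i ∈ I j, ψ x i = 0 := by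
  obtain ⟨hclean, V, m, D, ⟨hD, -⟩, hK⟩ := h
  choose K hK using hK
  obtain ⟨b, d, hd⟩ := hD.exists_adapted_basis (finrank_dual_tangentSpace q)
  obtain ⟨B, hB⟩ := exists_equiv_of_dual_basis b
  set c := chartAt (EuclideanSpace ℝ (Fin n)) q
  have hc : c ∈ IsManifold.maximalAtlas (𝓡 n) ω X := IsManifold.chart_mem_maximalAtlas q
  have hqc : q ∈ c.source := mem_chart_source _ q
  let I : Fin l → Set (Fin n) := fun j => ⋃ k ∈ K j, d k
  have hI : ∀ j, conormalFiber n (M j) q = Submodule.span ℝ (b '' I j) := fun j => by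
    simp only [hK j, hd, I, Set.image_iUnion, Submodule.span_iUnion]
  have hflat : ∀ j k, IsFlattenable {x | c.symm (B.symm x + c q) ∈ M j ∩ M k} (I j ∪ I k) := by
    intro j k
    refine (hclean j k).1.isFlattenable fun v => ?_
    -- Cleanness enters here: the sum of the two conormal fibres is the conormal fibre of the
    -- intersection.
    have h1 : conormalFiber n (M j ∩ M k) q = Submodule.span ℝ (b '' (I j ∪ I k)) := by
      rw [← (hclean j k).2, hI, hI, Set.image_union, Submodule.span_union]
    exact (mem_iff_forall_of_dualAnnihilator_eq_span h1 v).trans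
      (forall₂_congr fun i _ => by rw [hB])
  obtain ⟨G, hG, hGM⟩ := exists_flatten_family Finset.univ
    (fun j => {x | c.symm (B.symm x + c q) ∈ M j}) I hflat
  -- Inverse of the affine map `x ↦ B.symm x + c q` used in `hflat`; the final chart is `G ∘ s ∘ c`,
  -- suitably restricted.
  let s : EuclideanSpace ℝ (Fin n) → EuclideanSpace ℝ (Fin n) := fun y => B (y - c q)
  have hs0 : s (c q) = 0 := by simp [s]
  have hsc : ContDiff ℝ ω s := B.contDiff.comp (contDiff_id.sub contDiff_const)
  have hsd : HasFDerivAt s (B : EuclideanSpace ℝ (Fin n) →L[ℝ] _) (c q) :=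
    (B.hasFDerivAt.comp (c q) ((hasFDerivAt_id (c q)).sub_const (c q))).congr_fderiv
      (by ext; simp)
  have hev : ∀ᶠ x in 𝓝 (s (c q)), ∀ j,
      c.symm (B.symm x + c q) ∈ M j ↔ ∀ i ∈ I j, G x i = 0 := by
    rw [hs0]
    exact eventually_all.2 fun j => hGM j (Finset.mem_univ j)
  obtain ⟨ψ, hψ, hqψ, hψc, hψs⟩ := exists_chart_of_hasFDerivAt hc hqc (f := G ∘ s) (B := B)
    (ContDiffAt.comp (c q) (by rw [hs0]; exact hG.contDiffAt) hsc.contDiffAt)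
    ((HasFDerivAt.comp (c q) (by rw [hs0]; exact hG.hasFDerivAt) hsd).congr_fderiv
      (by ext; simp))
    (hsc.continuous.continuousAt.eventually hev)
  refine ⟨ψ, hψ, hqψ, ?_, I, fun j x hx => ?_⟩
  · rw [(hψs q hqψ).1, Function.comp_apply, hs0, hG.map_zero]
  · have h1 := (hψs x hx).2 j
    rw [(hψs x hx).1, Function.comp_apply, ← h1]
    simp [s, hψc hx]

end Linearization

/-- Injectivity of `ψ` on its source makes (ii) a pointwise condition there, the form both
implications use. -/
theorem image_inter_source_eq_iff {n : ℕ} {X : Type*} [TopologicalSpace X]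
    (ψ : OpenPartialHomeomorph X (EuclideanSpace ℝ (Fin n))) (S : Set X) (I : Set (Fin n)) :
    ψ '' (S ∩ ψ.source) = {x | x ∈ ψ.target ∧ ∀ i ∈ I, x i = 0} ↔
      ∀ x ∈ ψ.source, x ∈ S ↔ ∀ i ∈ I, ψ x i = 0 := by
  constructor
  · intro h x hx
    refine ⟨fun hxS => (h.subset ⟨x, ⟨hxS, hx⟩, rfl⟩).2, fun hxI => ?_⟩
    obtain ⟨y, ⟨hyS, hy⟩, hyx⟩ := h.superset ⟨ψ.map_source hx, hxI⟩
    rwa [← ψ.injOn hy hx hyx]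
  · intro h
    ext y
    constructor
    · rintro ⟨x, ⟨hxS, hx⟩, rfl⟩
      exact ⟨ψ.map_source hx, (h x hx).1 hxS⟩
    · rintro ⟨hy, hyI⟩
      refine ⟨ψ.symm y, ⟨(h _ (ψ.map_target hy)).2 ?_, ψ.map_target hy⟩, ψ.right_inv hy⟩
      rwa [ψ.right_inv hy]

theorem proposition1p2 (n : ℕ) {X : Type*} [TopologicalSpace X]
    [ChartedSpace (EuclideanSpace ℝ (Fin n)) X] [IsManifold (𝓡 n) ω X]
    {l : ℕ} (M : Fin l → Set X) (hM : ∀ j, IsClosedAnalyticSubmanifold n (M j))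
    (q : X) (hq : q ∈ ⋂ j, M j) :
    SimultaneouslyLinearizableAt n M q ↔
      ∃ ψ ∈ IsManifold.maximalAtlas (𝓡 n) ω X, q ∈ ψ.source ∧ ψ q = 0 ∧
        ∃ I : Fin l → Set (Fin n), ∀ j,
          ψ '' (M j ∩ ψ.source) = {x | x ∈ ψ.target ∧ ∀ i ∈ I j, x i = 0} := by
  simp only [image_inter_source_eq_iff]
  refine ⟨exists_chart_of_simultaneouslyLinearizableAt, ?_⟩
  rintro ⟨ψ, hψ, hqψ, -, I, hI⟩
  exact simultaneouslyLinearizableAt_of_chart (Set.mem_iInter.1 hq) hψ hqψ hI
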